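/- Let $(W,S)$ be a Coxeter system with $W$ finite, with length function $\ell$, Bruhat order $\leq$ and longest element $w_0$. Let $w\mapsto w^*$ be an automorphism of $W$ with $S^*=S$ and $(w^*)^*=w$ for all $w$, and let $\mathcal I_*=\{w\in W: w^{-1}=w^*\}$ be the set of twisted involutions. Let $\circ$ be the Demazure product on $W$, i.e. the unique associative operation such that for $s\in S$ and $w\in W$ one has $s\circ w=sw$ if $\ell(sw)>\ell(w)$ and $s\circ w=w$ otherwise, and $w\circ s=ws$ if $\ell(ws)>\ell(w)$ and $w\circ s=w$ otherwise. For $x,w\in W$ put $x\rtimes_{\circ} w=(w^*)^{-1}\circ x\circ w$. For $x,y\in\mathcal I_*$ let $\mathcal A_*(x,y)$ be the set of elements of minimal length in $\{w\in W: x\rtimes_{\circ} w=y\}$. For $x\in\mathcal I_*$ let $\hat\ell_*(x)$ be the least $k$ for which there are $s_1,\dots,s_k\in S$ with $(\cdots((1\rtimes_{\circ} s_1)\rtimes_{\circ} s_2)\cdots)\rtimes_{\circ} s_k=x$. Write $\ell(x,y)=\ell(y)-\ell(x)$ and $\hat\ell_*(x,y)=\hat\ell_*(y)-\hat\ell_*(x)$.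 For $x\in\mathcal I_*$ and $s\in S$ put $x\rtimes_* s=s^*xs$ if $s^*x\neq xs$ and $x\rtimes_* s=xs$ if $s^*x=xs$. Let $\leq_{T,*}$ be the reflexive transitive closure of the relation on $\mathcal I_*$ that relates $z$ to $z\rtimes_* s$ whenever $s\in S$ and $\hat\ell_*(z)<\hat\ell_*(z\rtimes_* s)$. (1) Let $x,y\in\mathcal I_*$ with $x\leq_{T,*}y$. If $\ell(x)=\hat\ell_*(x)$ or $\ell(y,w_0)=\hat\ell_*(y,w_0)$, then $\mathcal A_*(x,y)$ is equal to the set of minimal-length elements of $\{w\in W: w^*y\leq xw\}$. (2) For every $y\in\mathcal I_*$, the set $\mathcal A_*(1,y)$ is equal to the set of minimal-length elements of $\{w\in W: w^*y\leq w\}$. -/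

import Mathlib

namespace CoxeterSystem

noncomputable section

/-- The Bruhat order on `W`: the reflexive transitive closure of the relation `u → u * t`, where `t`
is a reflection (a conjugate of a simple generator) and `ℓ (u * t) > ℓ u`. -/
def BruhatLE {B W : Type*} [Group W] {M : CoxeterMatrix B} (cs : CoxeterSystem M W) : W → W → Prop :=
  Relation.ReflTransGen fun u v => ∃ t, cs.IsReflection t ∧ v = u * t ∧ cs.length u < cs.length v

/-- `w` is a longest element of `W`. -/
def IsLongest {B W : Type*} [Group W] {M : CoxeterMatrix B} (cs : CoxeterSystem M W) (w : W) :
    Prop :=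
  ∀ v : W, cs.length v ≤ cs.length w

/-- The elements of minimal length in a set `X`. -/
def minLength {B W : Type*} [Group W] {M : CoxeterMatrix B} (cs : CoxeterSystem M W) (X : Set W) :
    Set W :=
  {w | w ∈ X ∧ ∀ v ∈ X, cs.length w ≤ cs.length v}

/-- Some reduced word of `w`. -/
def someReducedWord {B W : Type*} [Group W] {M : CoxeterMatrix B} (cs : CoxeterSystem M W) (w : W) :
    List B :=
  Classical.choose (cs.exists_isReduced w)

theorem someReducedWord_spec {B W : Type*} [Group W] {M : CoxeterMatrix B}
    (cs : CoxeterSystem M W) (w : W) :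
    cs.IsReduced (cs.someReducedWord w) ∧ w = cs.wordProd (cs.someReducedWord w) :=
  Classical.choose_spec (cs.exists_isReduced w)

/-- `w ∘ s`, which is `w * s` if `ℓ w < ℓ (w * s)` and `w` otherwise, for the simple generator `s`
with index `i`. -/
def demazureSimple {B W : Type*} [Group W] {M : CoxeterMatrix B} (cs : CoxeterSystem M W) (w : W)
    (i : B) : W :=
  if cs.length w < cs.length (w * cs.simple i) then w * cs.simple i else w

/-- The Demazure product `u ∘ w = (⋯((u ∘ s₁) ∘ s₂) ⋯) ∘ sₖ`, where `s₁ s₂ ⋯ sₖ` is a reduced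
expression of `w`. (The value does not depend on which reduced expression is used.) -/
def demazure {B W : Type*} [Group W] {M : CoxeterMatrix B} (cs : CoxeterSystem M W) (u w : W) : W :=
  (cs.someReducedWord w).foldl cs.demazureSimple u

/-- `star` is an automorphism of `W` that preserves the set of simple generators and has
order 1 or 2. -/
structure IsDiagramInvolution {B W : Type*} [Group W] {M : CoxeterMatrix B}
    (cs : CoxeterSystem M W) (star : W ≃* W) : Prop where
  image_simple : star '' Set.range cs.simple = Set.range cs.simple
  involutive : ∀ w, star (star w) = w

/-- `(w^*)⁻¹ ∘ x ∘ w`. -/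
def twistedAct {B W : Type*} [Group W] {M : CoxeterMatrix B} (cs : CoxeterSystem M W)
    (star : W ≃* W) (x w : W) : W :=
  cs.demazure (cs.demazure (star w)⁻¹ x) w

/-- The Hecke atoms of `y` relative to `x`. -/
def heckeAtoms {B W : Type*} [Group W] {M : CoxeterMatrix B} (cs : CoxeterSystem M W)
    (star : W ≃* W) (x y : W) : Set W :=
  {w | cs.twistedAct star x w = y}

/-- The atoms of `y` relative to `x`. -/
def atoms {B W : Type*} [Group W] {M : CoxeterMatrix B} (cs : CoxeterSystem M W)
    (star : W ≃* W) (x y : W) : Set W :=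
  cs.minLength (cs.heckeAtoms star x y)

/-- The words `(s₁, …, sₖ)` for which acting on `x` successively by `s₁, …, sₖ` yields `y`. -/
def involutionExpressions {B W : Type*} [Group W] {M : CoxeterMatrix B} (cs : CoxeterSystem M W)
    (star : W ≃* W) (x y : W) : Set (List B) :=
  {ω | ω.foldl (fun z i => cs.twistedAct star z (cs.simple i)) x = y}

/-- The involution words of `y` relative to `x`: the expressions of shortest possible length. -/
def involutionWords {B W : Type*} [Group W] {M : CoxeterMatrix B} (cs : CoxeterSystem M W)
    (star : W ≃* W) (x y : W) : Set (List B) :=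
  {ω | ω ∈ cs.involutionExpressions star x y ∧
    ∀ ω' ∈ cs.involutionExpressions star x y, ω.length ≤ ω'.length}

/-- The common length of the involution words of the twisted involution `x` (relative to `1`). -/
def ellHat {B W : Type*} [Group W] {M : CoxeterMatrix B} (cs : CoxeterSystem M W)
    (star : W ≃* W) (x : W) : ℕ :=
  sInf (List.length '' cs.involutionWords star 1 x)

open Classical in
/-- `x ⋊ s`, which is `s^* x s` if `s^* x ≠ x s`, and `x s` otherwise. -/
def twistedConj {B W : Type*} [Group W] {M : CoxeterMatrix B} (cs : CoxeterSystem M W)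
    (star : W ≃* W) (x : W) (i : B) : W :=
  if star (cs.simple i) * x ≠ x * cs.simple i then star (cs.simple i) * x * cs.simple i
  else x * cs.simple i

/-- The two-sided weak order on twisted involutions: the reflexive transitive closure of the
relation `z < z ⋊ s` whenever the involution length increases. -/
def TwistedWeakLE {B W : Type*} [Group W] {M : CoxeterMatrix B} (cs : CoxeterSystem M W)
    (star : W ≃* W) : W → W → Prop :=
  Relation.ReflTransGen fun z z' => z⁻¹ = star z ∧ ∃ i : B, z' = cs.twistedConj star z i ∧
    cs.ellHat star z < cs.ellHat star z'

end

end CoxeterSystem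

/-- The set of twisted involutions `{w | w⁻¹ = w^*}`. -/
def twistedInvolutions {W : Type*} [Group W] (star : W ≃* W) : Set W :=
  {w | w⁻¹ = star w}

/-! Both sets turn out to be cut out by one length, `d = ellHat y - ellHat x`. If `w^* y ≤ x w`,
monotonicity of the Demazure product gives `y ≤ (w^*)⁻¹ ∘ (w^* y) ≤ (w^*)⁻¹ ∘ x ∘ w`
(`bruhatLE_twistedAct`). The involution length is strictly increasing for the Bruhat order on
twisted involutions (`eq_of_ellHat_le`), and acting by `w` raises it by at most `ℓ w`. Hence `ℓ w ≥
d`, and `ℓ w = d` forces the action of `w` to send `x` to `y`.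

Conversely, an atom `w` satisfies `x ∘ w = x w`, since otherwise a shorter element would act in the
same way (`demazure_eq_mul_or_exists_lt`). So `y = (w^*)⁻¹ ∘ (x w)`, and the general bound `u⁻¹ (u ∘
v) ≤ v` yields `w^* y ≤ x w`. A weak-order chain from `x` to `y` supplies a word of length exactly
`d`, so the minimum `d` is attained on both sides.

The Bruhat input is the lifting property, deduced from the parity cocycle of inversions. -/

namespace CoxeterSystem

/-! ### The inversion cocycle and reflections that lengthen an element -/

section ReflectionCocycle

variable {B W : Type*} [Group W] {M : CoxeterMatrix B} (cs : CoxeterSystem M W)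

open Classical in
/-- The map `(g, ε) ↦ (s g s, ε + [g = s])` for a simple generator `s`. -/
noncomputable def reflectionFun (i : B) (p : W × ZMod 2) : W × ZMod 2 :=
  (cs.simple i * p.1 * cs.simple i, p.2 + if p.1 = cs.simple i then 1 else 0)

theorem reflectionFun_reflectionFun (i : B) (p : W × ZMod 2) :
    cs.reflectionFun i (cs.reflectionFun i p) = p := by
  rcases p with ⟨g, ε⟩
  have h : cs.simple i * g * cs.simple i = cs.simple i ↔ g = cs.simple i := by
    constructor
    · intro h
      have := congrArg (fun x => cs.simple i * x * cs.simple i) h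
      simpa [mul_assoc] using this
    · rintro rfl
      simp
  simp only [reflectionFun, h]
  ext
  · simp [mul_assoc]
  · by_cases hg : g = cs.simple i
    · simp [hg, add_assoc, CharTwo.add_self_eq_zero]
    · simp [h, hg]

/-- The permutation of `W × ZMod 2` attached to a simple generator. -/
noncomputable def reflectionPerm (i : B) : Equiv.Perm (W × ZMod 2) :=
  ⟨cs.reflectionFun i, cs.reflectionFun i, cs.reflectionFun_reflectionFun i,
    cs.reflectionFun_reflectionFun i⟩

-- The condition `r ^ k * g = s_j` runs through the reflections of the dihedral group generated by
-- `s_i` and `s_j`. Over a full period each occurs an even number of times, which is the braid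
-- relation needed for lifting.
open Classical in
theorem reflectionPerm_mul_pow_apply (i j : B) (n : ℕ) (g : W) (ε : ZMod 2) :
    ((cs.reflectionPerm i * cs.reflectionPerm j) ^ n) (g, ε) =
      ((cs.simple i * cs.simple j) ^ n * g * ((cs.simple i * cs.simple j) ^ n)⁻¹,
        ε + ∑ k ∈ Finset.range (2 * n),
          if (cs.simple i * cs.simple j) ^ k * g = cs.simple j then 1 else 0) := by
  set r := cs.simple i * cs.simple j with hr
  have hinv : r⁻¹ = cs.simple j * cs.simple i := by simp [hr]
  have hconj : ∀ k : ℕ, cs.simple j * r ^ k = (r ^ k)⁻¹ * cs.simple j := by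
    intro k
    have h : SemiconjBy (cs.simple j) r r⁻¹ := by
      rw [SemiconjBy, hinv, hr, mul_assoc]
    rw [← inv_pow]
    exact h.pow_right k
  induction n with
  | zero => simp
  | succ n ih =>
    have h1 : r ^ n * g * (r ^ n)⁻¹ = cs.simple j ↔ r ^ (2 * n) * g = cs.simple j := by
      rw [mul_inv_eq_iff_eq_mul, hconj, eq_inv_mul_iff_mul_eq, two_mul, pow_add, mul_assoc]
    have h2 : cs.simple j * (r ^ n * g * (r ^ n)⁻¹) * cs.simple j = cs.simple i ↔
        r ^ (2 * n + 1) * g = cs.simple j := by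
      have e : r ^ (2 * n + 1) * g = r ^ n * (r * (r ^ n * g)) := by
        rw [two_mul, add_assoc, pow_add, pow_succ']; simp only [mul_assoc]
      have e' : cs.simple j * (r ^ n * g * (r ^ n)⁻¹) * cs.simple j = cs.simple i ↔
          r ^ n * g * (r ^ n)⁻¹ = r⁻¹ * cs.simple j := by
        rw [hinv, ← eq_mul_inv_iff_mul_eq, inv_simple, ← eq_inv_mul_iff_mul_eq, inv_simple]
        simp only [mul_assoc]
      rw [e, e', mul_inv_eq_iff_eq_mul, mul_assoc, hconj, eq_inv_mul_iff_mul_eq,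
        eq_inv_mul_iff_mul_eq]
    rw [pow_succ', Equiv.Perm.mul_apply, ih, Equiv.Perm.mul_apply]
    change cs.reflectionFun i (cs.reflectionFun j _) = _
    simp only [reflectionFun, h1, h2]
    ext
    · simp [pow_succ', hr, mul_assoc]
    · rw [show 2 * (n + 1) = 2 * n + 1 + 1 by ring, Finset.sum_range_succ, Finset.sum_range_succ]
      simp only [add_assoc]

theorem isLiftable_reflectionPerm : M.IsLiftable cs.reflectionPerm := by
  classical
  intro i j
  ext1 ⟨g, ε⟩
  -- As `(s_i s_j) ^ m = 1` for `m = M i j`, the indices `k` and `m + k` contribute equally and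
  -- cancel modulo 2.
  rw [reflectionPerm_mul_pow_apply, cs.simple_mul_simple_pow, two_mul, Finset.sum_range_add]
  simp [pow_add, cs.simple_mul_simple_pow, CharTwo.add_self_eq_zero]

/-- The action of `W` on `W × ZMod 2` that records inversions. -/
noncomputable def reflectionAction : W →* Equiv.Perm (W × ZMod 2) :=
  cs.lift ⟨cs.reflectionPerm, cs.isLiftable_reflectionPerm⟩

theorem reflectionAction_simple (i : B) :
    cs.reflectionAction (cs.simple i) = cs.reflectionPerm i := by
  simp [reflectionAction]

/-- The parity of the number of times `g` occurs in the inversion sequence of a word for `w`. -/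
noncomputable def inversionParity (w g : W) : ZMod 2 :=
  (cs.reflectionAction w (g, 0)).2

theorem reflectionAction_apply (w g : W) (ε : ZMod 2) :
    cs.reflectionAction w (g, ε) = (w * g * w⁻¹, ε + cs.inversionParity w g) := by
  induction w using cs.simple_induction_left generalizing g ε with
  | one => simp [inversionParity]
  | mul_simple_left w i ih =>
    have h : ∀ ε, cs.reflectionAction (cs.simple i * w) (g, ε) =
        cs.reflectionFun i (w * g * w⁻¹, ε + cs.inversionParity w g) := by
      intro ε
      rw [map_mul, Equiv.Perm.mul_apply, ih, reflectionAction_simple]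
      rfl
    rw [inversionParity, h, h]
    ext
    · simp [reflectionFun, mul_assoc]
    · simp [reflectionFun, add_assoc]

theorem inversionParity_mul (u v g : W) :
    cs.inversionParity (u * v) g =
      cs.inversionParity v g + cs.inversionParity u (v * g * v⁻¹) := by
  rw [inversionParity, map_mul, Equiv.Perm.mul_apply, reflectionAction_apply,
    reflectionAction_apply]
  simp

theorem inversionParity_one (g : W) : cs.inversionParity 1 g = 0 := by
  simp [inversionParity]

open Classical in
theorem inversionParity_simple (i : B) (g : W) :
    cs.inversionParity (cs.simple i) g = if g = cs.simple i then 1 else 0 := by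
  rw [inversionParity, reflectionAction_simple]
  simp [reflectionPerm, reflectionFun]

theorem inversionParity_self {t : W} (ht : cs.IsReflection t) : cs.inversionParity t t = 1 := by
  obtain ⟨v, i, rfl⟩ := ht
  have h := cs.inversionParity_mul v v⁻¹ (v * cs.simple i * v⁻¹)
  rw [mul_inv_cancel, inversionParity_one] at h
  rw [inversionParity_mul, inversionParity_mul]
  simp only [mul_assoc, inv_mul_cancel_left, inv_inv, inv_mul_cancel, mul_one,
    inversionParity_simple, if_true, inv_simple, simple_mul_simple_self, one_mul] at h ⊢
  rw [add_left_comm, ← h, add_zero]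

theorem mem_rightInvSeq_of_inversionParity_ne_zero (ω : List B) {g : W}
    (h : cs.inversionParity (cs.wordProd ω) g ≠ 0) : g ∈ cs.rightInvSeq ω := by
  classical
  induction ω with
  | nil => simp [inversionParity_one] at h
  | cons i ω ih =>
    rw [wordProd_cons, inversionParity_mul, inversionParity_simple] at h
    rw [rightInvSeq, List.mem_cons]
    by_cases hg : cs.wordProd ω * g * (cs.wordProd ω)⁻¹ = cs.simple i
    · left
      rw [← hg]
      group
    · right
      rw [if_neg hg, add_zero] at h
      exact ih h

/-- The parity does not depend on the word, so a reduced word can be used: an odd count puts `t` in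
its inversion sequence. For the converse, passing from `w` to `w t` flips the parity, so an even
count makes `t` an inversion of `w t`. -/
theorem inversionParity_ne_zero_iff (w : W) {t : W} (ht : cs.IsReflection t) :
    cs.inversionParity w t ≠ 0 ↔ cs.length (w * t) < cs.length w := by
  have key : ∀ w, cs.inversionParity w t ≠ 0 → cs.length (w * t) < cs.length w := by
    intro w h
    obtain ⟨ω, hω, rfl⟩ := cs.exists_isReduced w
    exact (cs.isRightInversion_of_mem_rightInvSeq hω
      (cs.mem_rightInvSeq_of_inversionParity_ne_zero ω h)).2
  refine ⟨key w, fun h h0 => ?_⟩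
  have h1 := key (w * t) (by
    rw [inversionParity_mul, cs.inversionParity_self ht, mul_inv_cancel_right, h0]
    decide)
  rw [mul_assoc, ht.mul_self, mul_one] at h1
  exact lt_asymm h h1

/-- A reflection `t ≠ s` that lengthens `u` also lengthens `us` after conjugation by `s`, provided
that `s` lengthens `u`. -/
theorem length_mul_simple_lt_length_mul_mul_simple {u t : W} (ht : cs.IsReflection t) {i : B}
    (hne : t ≠ cs.simple i) (hut : cs.length u < cs.length (u * t)) :
    cs.length (u * cs.simple i) < cs.length (u * t * cs.simple i) := by
  have ht' : cs.IsReflection (cs.simple i * t * cs.simple i) := by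
    simpa using ht.conj (cs.simple i)
  have e : u * t * cs.simple i = u * cs.simple i * (cs.simple i * t * cs.simple i) := by
    simp [mul_assoc]
  rw [e]
  refine lt_of_le_of_ne ?_ (ht'.length_mul_left_ne _).symm
  -- Since `s t s ≠ s`, the letter `s` contributes nothing, and the parity of `u s` at `s t s` is
  -- that of `u` at `t`.
  rw [← not_lt, ← cs.inversionParity_ne_zero_iff _ ht', not_not, inversionParity_mul,
    inversionParity_simple, if_neg, zero_add]
  · have h := (cs.inversionParity_ne_zero_iff u ht).not.mpr (not_lt.mpr hut.le)
    simpa [mul_assoc] using h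
  · intro h
    apply hne
    have := congrArg (fun x => cs.simple i * x * cs.simple i) h
    simpa [mul_assoc] using this

end ReflectionCocycle

/-! ### Bruhat order, the lifting property, and Demazure steps on either side -/

section Bruhat

variable {B W : Type*} [Group W] {M : CoxeterMatrix B} (cs : CoxeterSystem M W)

variable {cs} in
theorem BruhatLE.trans {u v w : W} (h : cs.BruhatLE u v) (h' : cs.BruhatLE v w) :
    cs.BruhatLE u w :=
  Relation.ReflTransGen.trans h h'

theorem bruhatLE_refl (u : W) : cs.BruhatLE u u := Relation.ReflTransGen.refl

theorem bruhatLE_mul_reflection {u t : W} (ht : cs.IsReflection t)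
    (h : cs.length u < cs.length (u * t)) : cs.BruhatLE u (u * t) :=
  Relation.ReflTransGen.single ⟨t, ht, rfl, h⟩

theorem bruhatLE_mul_simple {u : W} {i : B} (h : cs.length u < cs.length (u * cs.simple i)) :
    cs.BruhatLE u (u * cs.simple i) :=
  cs.bruhatLE_mul_reflection (cs.isReflection_simple i) h

theorem mul_simple_bruhatLE {u : W} {i : B} (h : cs.length (u * cs.simple i) < cs.length u) :
    cs.BruhatLE (u * cs.simple i) u := by
  have := cs.bruhatLE_mul_simple (u := u * cs.simple i) (i := i) (by simpa using h)
  simpa using this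

variable {cs} in
theorem BruhatLE.length_le {u v : W} (h : cs.BruhatLE u v) : cs.length u ≤ cs.length v := by
  induction h with
  | refl => rfl
  | tail _ h ih =>
    obtain ⟨t, -, -, h⟩ := h
    exact ih.trans h.le

variable {cs} in
theorem BruhatLE.eq_of_length_le {u v : W} (h : cs.BruhatLE u v)
    (h' : cs.length v ≤ cs.length u) : u = v := by
  rcases Relation.ReflTransGen.cases_tail h with h | ⟨w, hw, t, -, -, hl⟩
  · exact h.symm
  · exact absurd (BruhatLE.length_le hw) (by lia)

variable {cs} in
theorem BruhatLE.inv {u v : W} (h : cs.BruhatLE u v) : cs.BruhatLE u⁻¹ v⁻¹ := by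
  induction h with
  | refl => exact cs.bruhatLE_refl _
  | @tail v w _ h ih =>
    obtain ⟨t, ht, rfl, hl⟩ := h
    refine ih.trans ?_
    have e : (v * t)⁻¹ = v⁻¹ * (v * t * v⁻¹) := by simp [ht.inv, mul_assoc]
    rw [e]
    refine cs.bruhatLE_mul_reflection (ht.conj v) ?_
    rwa [← e, length_inv, length_inv]

/-- The smaller of `w` and `ws`. -/
noncomputable def descendSimple (w : W) (i : B) : W :=
  if cs.length (w * cs.simple i) < cs.length w then w * cs.simple i else w

theorem demazureSimple_of_lt {w : W} {i : B} (h : cs.length w < cs.length (w * cs.simple i)) :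
    cs.demazureSimple w i = w * cs.simple i := if_pos h

theorem demazureSimple_of_gt {w : W} {i : B} (h : cs.length (w * cs.simple i) < cs.length w) :
    cs.demazureSimple w i = w := if_neg h.not_gt

theorem lt_or_gt_length_mul_simple (w : W) (i : B) :
    cs.length w < cs.length (w * cs.simple i) ∨ cs.length (w * cs.simple i) < cs.length w :=
  lt_or_gt_of_ne (cs.length_mul_simple_ne w i).symm

theorem bruhatLE_demazureSimple (w : W) (i : B) : cs.BruhatLE w (cs.demazureSimple w i) := by
  rcases cs.lt_or_gt_length_mul_simple w i with h | h
  · rw [cs.demazureSimple_of_lt h]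
    exact cs.bruhatLE_mul_simple h
  · rw [cs.demazureSimple_of_gt h]
    exact cs.bruhatLE_refl w

theorem mul_simple_bruhatLE_demazureSimple (w : W) (i : B) :
    cs.BruhatLE (w * cs.simple i) (cs.demazureSimple w i) := by
  rcases cs.lt_or_gt_length_mul_simple w i with h | h
  · rw [cs.demazureSimple_of_lt h]
    exact cs.bruhatLE_refl _
  · rw [cs.demazureSimple_of_gt h]
    exact cs.mul_simple_bruhatLE h

theorem descendSimple_bruhatLE (w : W) (i : B) : cs.BruhatLE (cs.descendSimple w i) w := by
  rw [descendSimple]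
  split_ifs with h
  · exact cs.mul_simple_bruhatLE h
  · exact cs.bruhatLE_refl _

-- It suffices to treat one edge `u → u t`. If `s` lengthens `u` and `t ≠ s`, then `u s → u t s` is
-- again an edge, with reflection `s t s`; the other cases follow from `v ≤ v ∘ s`.
variable {cs} in
theorem BruhatLE.demazureSimple {u v : W} (h : cs.BruhatLE u v) (i : B) :
    cs.BruhatLE (cs.demazureSimple u i) (cs.demazureSimple v i) := by
  induction h with
  | refl => exact cs.bruhatLE_refl _
  | @tail u v _ h ih =>
    refine ih.trans ?_
    obtain ⟨t, ht, rfl, hl⟩ := h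
    rcases cs.lt_or_gt_length_mul_simple u i with h | h
    · rw [cs.demazureSimple_of_lt h]
      by_cases hne : t = cs.simple i
      · rw [hne]
        exact cs.bruhatLE_demazureSimple _ _
      · have hK := cs.length_mul_simple_lt_length_mul_mul_simple ht hne hl
        refine BruhatLE.trans ?_ (cs.mul_simple_bruhatLE_demazureSimple _ i)
        have ht' : cs.IsReflection (cs.simple i * t * cs.simple i) := by
          simpa using ht.conj (cs.simple i)
        have e : u * t * cs.simple i = u * cs.simple i * (cs.simple i * t * cs.simple i) := by
          simp [mul_assoc]
        rw [e] at hK ⊢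
        exact cs.bruhatLE_mul_reflection ht' hK
    · rw [cs.demazureSimple_of_gt h]
      exact (cs.bruhatLE_mul_reflection ht hl).trans (cs.bruhatLE_demazureSimple _ _)

variable {cs} in
theorem BruhatLE.descendSimple {u v : W} (h : cs.BruhatLE u v) (i : B) :
    cs.BruhatLE (cs.descendSimple u i) (cs.descendSimple v i) := by
  induction h with
  | refl => exact cs.bruhatLE_refl _
  | @tail u v _ h ih =>
    refine ih.trans ?_
    obtain ⟨t, ht, rfl, hl⟩ := h
    have ht' : cs.IsReflection (cs.simple i * t * cs.simple i) := by
      simpa using ht.conj (cs.simple i)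
    have e : u * t * cs.simple i = u * cs.simple i * (cs.simple i * t * cs.simple i) := by
      simp [mul_assoc]
    have e' : u * t * cs.simple i * (cs.simple i * t * cs.simple i) = u * cs.simple i := by
      rw [e, mul_assoc _ _ (cs.simple i * t * cs.simple i), ht'.mul_self, mul_one]
    by_cases hv : cs.length (u * t * cs.simple i) < cs.length (u * t)
    · rw [show cs.descendSimple (u * t) i = u * t * cs.simple i from if_pos hv]
      rcases cs.lt_or_gt_length_mul_simple u i with h | h
      · rw [show cs.descendSimple u i = u from if_neg h.not_gt]
        by_cases hne : t = cs.simple i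
        · simpa [hne] using cs.bruhatLE_refl u
        · have hK := cs.length_mul_simple_lt_length_mul_mul_simple ht hne hl
          refine (cs.bruhatLE_mul_simple h).trans ?_
          rw [e] at hK ⊢
          exact cs.bruhatLE_mul_reflection ht' hK
      · rw [show cs.descendSimple u i = u * cs.simple i from if_pos h]
        -- Were the inequality reversed, `s t s` would lengthen `u t s`; multiplying by `s` would
        -- then give `ℓ (u t) < ℓ u`.
        have hlt : cs.length (u * cs.simple i) < cs.length (u * t * cs.simple i) := by
          by_contra hcon
          have hlt : cs.length (u * t * cs.simple i) < cs.length (u * cs.simple i) := by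
            refine lt_of_le_of_ne (not_lt.mp hcon) ?_
            rw [e]
            exact ht'.length_mul_left_ne _
          by_cases hne : cs.simple i * t * cs.simple i = cs.simple i
          · have : t = cs.simple i := by
              have := congrArg (fun x => cs.simple i * x * cs.simple i) hne
              simpa [mul_assoc] using this
            rw [this] at hl
            exact lt_asymm hl h
          · have hK := cs.length_mul_simple_lt_length_mul_mul_simple (u := u * t * cs.simple i)
              ht' hne (by rwa [e'])
            rw [e'] at hK
            simp only [simple_mul_simple_cancel_right] at hK
            exact lt_asymm hl hK
        rw [e] at hlt ⊢
        exact cs.bruhatLE_mul_reflection ht' hlt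
    · rw [show cs.descendSimple (u * t) i = u * t from if_neg hv]
      exact (cs.descendSimple_bruhatLE u i).trans (cs.bruhatLE_mul_reflection ht hl)

-- This is the lifting property: the projection `descendSimple` fixes `u` and sends `v ∘ s` below
-- `v`.
variable {cs} in
theorem BruhatLE.of_demazureSimple {u v : W} {i : B} (h : cs.BruhatLE u (cs.demazureSimple v i))
    (hu : cs.length u < cs.length (u * cs.simple i)) : cs.BruhatLE u v := by
  have h' := h.descendSimple i
  rw [show cs.descendSimple u i = u from if_neg hu.not_gt] at h'
  refine h'.trans ?_
  rcases cs.lt_or_gt_length_mul_simple v i with hv | hv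
  · rw [cs.demazureSimple_of_lt hv, CoxeterSystem.descendSimple, if_pos (by simpa using hv)]
    simpa using cs.bruhatLE_refl v
  · rw [cs.demazureSimple_of_gt hv]
    exact cs.descendSimple_bruhatLE v i

/-- `s ∘ w` for the simple generator `s` with index `i`. -/
noncomputable def simpleDemazure (i : B) (w : W) : W :=
  if cs.length w < cs.length (cs.simple i * w) then cs.simple i * w else w

theorem simpleDemazure_of_lt {w : W} {i : B} (h : cs.length w < cs.length (cs.simple i * w)) :
    cs.simpleDemazure i w = cs.simple i * w := if_pos h

theorem simpleDemazure_of_gt {w : W} {i : B} (h : cs.length (cs.simple i * w) < cs.length w) :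
    cs.simpleDemazure i w = w := if_neg h.not_gt

theorem lt_or_gt_length_simple_mul (w : W) (i : B) :
    cs.length w < cs.length (cs.simple i * w) ∨ cs.length (cs.simple i * w) < cs.length w :=
  lt_or_gt_of_ne (cs.length_simple_mul_ne w i).symm

theorem length_inv_mul_simple (w : W) (i : B) :
    cs.length (w⁻¹ * cs.simple i) = cs.length (cs.simple i * w) := by
  rw [← cs.length_inv (cs.simple i * w), mul_inv_rev, inv_simple]

theorem simpleDemazure_inv (i : B) (w : W) :
    cs.simpleDemazure i w⁻¹ = (cs.demazureSimple w i)⁻¹ := by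
  have h : cs.length (cs.simple i * w⁻¹) = cs.length (w * cs.simple i) := by
    rw [← length_inv_mul_simple, inv_inv]
  rw [simpleDemazure, demazureSimple, h, length_inv]
  split_ifs <;> simp

theorem inv_simpleDemazure (i : B) (w : W) :
    (cs.simpleDemazure i w)⁻¹ = cs.demazureSimple w⁻¹ i := by
  rw [← inv_inj, ← simpleDemazure_inv, inv_inv, inv_inv]

theorem simpleDemazure_eq (i : B) (w : W) :
    cs.simpleDemazure i w = (cs.demazureSimple w⁻¹ i)⁻¹ := by
  rw [← inv_simpleDemazure, inv_inv]

variable {cs} in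
theorem BruhatLE.simpleDemazure {u v : W} (h : cs.BruhatLE u v) (i : B) :
    cs.BruhatLE (cs.simpleDemazure i u) (cs.simpleDemazure i v) := by
  rw [simpleDemazure_eq, simpleDemazure_eq]
  exact (h.inv.demazureSimple i).inv

theorem bruhatLE_simpleDemazure (i : B) (w : W) : cs.BruhatLE w (cs.simpleDemazure i w) := by
  have := (cs.bruhatLE_demazureSimple w⁻¹ i).inv
  rwa [inv_inv, ← simpleDemazure_eq] at this

variable {cs} in
theorem BruhatLE.of_simpleDemazure {u v : W} {i : B} (h : cs.BruhatLE u (cs.simpleDemazure i v))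
    (hu : cs.length u < cs.length (cs.simple i * u)) : cs.BruhatLE u v := by
  rw [simpleDemazure_eq] at h
  have h' := h.inv
  rw [inv_inv] at h'
  have := (h'.of_demazureSimple (by rwa [length_inv_mul_simple, length_inv])).inv
  simpa using this

/-- Left and right multiplication by simple generators that both lengthen `w` agree if their
composite does not change the length. -/
theorem simple_mul_eq_mul_simple {w : W} {i j : B}
    (hi : cs.length w < cs.length (cs.simple i * w))
    (hj : cs.length w < cs.length (w * cs.simple j))
    (hij : cs.length (cs.simple i * w * cs.simple j) < cs.length (cs.simple i * w)) :
    cs.simple i * w = w * cs.simple j := by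
  have ht : cs.IsReflection (w⁻¹ * cs.simple i * w) := by
    simpa using (cs.isReflection_simple i).conj w⁻¹
  have e : w * (w⁻¹ * cs.simple i * w) = cs.simple i * w := by group
  by_contra hne
  -- The reflection `t = w⁻¹ s_i w` satisfies `w t = s_i w`. If `t ≠ s_j`, then `ℓ w + 1 < ℓ (s_i w
  -- s_j) < ℓ (s_i w) = ℓ w + 1`.
  have hK := cs.length_mul_simple_lt_length_mul_mul_simple (u := w) (i := j) ht
    (fun h => hne (by rw [← e, h])) (by rwa [e])
  rw [e] at hK
  have h1 := cs.length_simple_mul w i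
  have h2 := cs.length_mul_simple w j
  lia

/-- This is the source of associativity. The delicate case is when both factors lengthen `w` but not
jointly; then `s_i w = w s_j`. -/
theorem simpleDemazure_demazureSimple (i j : B) (w : W) :
    cs.simpleDemazure i (cs.demazureSimple w j) = cs.demazureSimple (cs.simpleDemazure i w) j := by
  have h1 := cs.length_simple_mul w i
  have h2 := cs.length_mul_simple w j
  have h3 := cs.length_simple_mul (w * cs.simple j) i
  have h4 := cs.length_mul_simple (cs.simple i * w) j
  rw [mul_assoc] at h4
  have heq := cs.simple_mul_eq_mul_simple (w := w) (i := i) (j := j)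
  rw [mul_assoc] at heq
  rcases cs.lt_or_gt_length_simple_mul w i with hi | hi <;>
    rcases cs.lt_or_gt_length_mul_simple w j with hj | hj
  · rw [cs.demazureSimple_of_lt hj, cs.simpleDemazure_of_lt hi]
    by_cases hij : cs.length (cs.simple i * (w * cs.simple j)) < cs.length (cs.simple i * w)
    · rw [cs.simpleDemazure_of_gt (by lia), cs.demazureSimple_of_gt (by rwa [mul_assoc])]
      exact (heq hi hj hij).symm
    · rw [cs.simpleDemazure_of_lt (by lia),
        cs.demazureSimple_of_lt (by rw [mul_assoc]; lia), mul_assoc]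
  · rw [cs.demazureSimple_of_gt hj, cs.simpleDemazure_of_lt hi,
      cs.demazureSimple_of_gt (by rw [mul_assoc]; lia)]
  · rw [cs.demazureSimple_of_lt hj, cs.simpleDemazure_of_gt hi, cs.demazureSimple_of_lt hj,
      cs.simpleDemazure_of_gt (by lia)]
  · rw [cs.demazureSimple_of_gt hj, cs.simpleDemazure_of_gt hi, cs.demazureSimple_of_gt hj]

theorem exists_eq_mul_simple_of_ne_one {w : W} (hw : w ≠ 1) :
    ∃ v i, w = v * cs.simple i ∧ cs.length w = cs.length v + 1 ∧ cs.demazureSimple v i = w := by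
  obtain ⟨i, hi⟩ := cs.exists_rightDescent_of_ne_one hw
  have h := cs.isRightDescent_iff.mp hi
  refine ⟨w * cs.simple i, i, by simp, h.symm, ?_⟩
  rw [cs.demazureSimple_of_lt] <;> simp
  lia

/-- Induction along right multiplications by simple generators that increase the length. -/
theorem induction_demazureSimple {p : W → Prop} (one : p 1)
    (step : ∀ v i, cs.length v < cs.length (v * cs.simple i) → p v → p (v * cs.simple i)) (w : W) :
    p w := by
  induction hn : cs.length w generalizing w with
  | zero =>
    rw [cs.length_eq_zero_iff.mp hn]
    exact one
  | succ n ih =>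
    obtain ⟨v, i, rfl, hl, -⟩ := cs.exists_eq_mul_simple_of_ne_one (w := w) (by
      rintro rfl
      simp at hn)
    exact step v i (by lia) (ih v (by lia))

/-- Induction along left multiplications by simple generators that increase the length. -/
theorem induction_simpleDemazure {p : W → Prop} (one : p 1)
    (step : ∀ i v, cs.length v < cs.length (cs.simple i * v) → p v → p (cs.simple i * v)) (w : W) :
    p w := by
  have := cs.induction_demazureSimple (p := fun w => p w⁻¹) (by simpa using one) (by
    intro v i hl hv
    have := step i v⁻¹ (by
      rw [length_inv, ← length_inv_mul_simple, inv_inv]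
      exact hl) hv
    simpa using this) w⁻¹
  simpa using this

end Bruhat

/-! ### Associativity and Bruhat estimates for the Demazure product -/

section Demazure

variable {B W : Type*} [Group W] {M : CoxeterMatrix B} (cs : CoxeterSystem M W)

theorem demazure_one_right (u : W) : cs.demazure u 1 = u := by
  obtain ⟨h, h'⟩ := cs.someReducedWord_spec 1
  have : cs.someReducedWord 1 = [] := by
    rw [← List.length_eq_zero_iff, ← h.eq, ← h', length_one]
  rw [demazure, this, List.foldl_nil]

theorem foldl_demazureSimple_one {ω : List B} (hω : cs.IsReduced ω) :
    ω.foldl cs.demazureSimple 1 = cs.wordProd ω := by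
  induction ω using List.reverseRecOn with
  | nil => simp
  | append_singleton ω i ih =>
    have h := hω.take ω.length
    rw [List.take_left] at h
    rw [List.foldl_append, ih h, List.foldl_cons, List.foldl_nil, demazureSimple_of_lt,
      wordProd_append, wordProd_singleton]
    have h1 := hω.eq
    have h2 := h.eq
    rw [wordProd_append, wordProd_singleton, List.length_append, List.length_singleton] at h1
    lia

theorem demazure_one_left (w : W) : cs.demazure 1 w = w := by
  obtain ⟨h, h'⟩ := cs.someReducedWord_spec w
  rw [demazure, cs.foldl_demazureSimple_one h, ← h']

theorem demazure_simpleDemazure (i : B) (u w : W) :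
    cs.demazure (cs.simpleDemazure i u) w = cs.simpleDemazure i (cs.demazure u w) := by
  rw [demazure, demazure]
  induction cs.someReducedWord w generalizing u with
  | nil => rfl
  | cons j ω ih => rw [List.foldl_cons, List.foldl_cons, ← ih, simpleDemazure_demazureSimple]

/-- Peeling `u` off from the left reduces to `u = 1`, where the product is `w` itself; this removes
the dependence on the chosen reduced word. -/
theorem demazure_demazureSimple (u w : W) (i : B) :
    cs.demazure u (cs.demazureSimple w i) = cs.demazureSimple (cs.demazure u w) i := by
  induction u using cs.induction_simpleDemazure with
  | one => rw [demazure_one_left, demazure_one_left]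
  | step j u h ih =>
    rw [← cs.simpleDemazure_of_lt h, demazure_simpleDemazure, demazure_simpleDemazure, ih,
      simpleDemazure_demazureSimple]

theorem demazure_assoc (u v w : W) :
    cs.demazure (cs.demazure u v) w = cs.demazure u (cs.demazure v w) := by
  induction u using cs.induction_simpleDemazure with
  | one => rw [demazure_one_left, demazure_one_left]
  | step j u h ih =>
    rw [← cs.simpleDemazure_of_lt h, demazure_simpleDemazure, demazure_simpleDemazure,
      demazure_simpleDemazure, ih]

theorem demazure_simple_left (i : B) (w : W) :
    cs.demazure (cs.simple i) w = cs.simpleDemazure i w := by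
  have h : cs.simple i = cs.simpleDemazure i 1 := by
    rw [simpleDemazure_of_lt] <;> simp
  rw [h, demazure_simpleDemazure, demazure_one_left]

theorem demazure_simple_right (w : W) (i : B) :
    cs.demazure w (cs.simple i) = cs.demazureSimple w i := by
  have h : cs.simple i = cs.demazureSimple 1 i := by
    rw [demazureSimple_of_lt] <;> simp
  rw [h, demazure_demazureSimple, demazure_one_right]

theorem mul_bruhatLE_demazure (u w : W) : cs.BruhatLE (u * w) (cs.demazure u w) := by
  induction w using cs.induction_demazureSimple with
  | one => simpa [demazure_one_right] using cs.bruhatLE_refl u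
  | step v i h ih =>
    rw [← cs.demazureSimple_of_lt h, demazure_demazureSimple, cs.demazureSimple_of_lt h,
      ← mul_assoc]
    exact (cs.mul_simple_bruhatLE_demazureSimple _ i).trans (ih.demazureSimple i)

variable {cs} in
theorem BruhatLE.demazure_left {v w : W} (h : cs.BruhatLE v w) (u : W) :
    cs.BruhatLE (cs.demazure u v) (cs.demazure u w) := by
  induction u using cs.induction_simpleDemazure with
  | one => simpa [demazure_one_left] using h
  | step i u h ih =>
    rw [← cs.simpleDemazure_of_lt h, demazure_simpleDemazure, demazure_simpleDemazure]
    exact ih.simpleDemazure i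

/-- Building up `w` letter by letter, each letter is either appended to `u⁻¹ (u ∘ w)` or skipped, so
this element stays below `w`. -/
theorem inv_mul_demazure_bruhatLE (u w : W) : cs.BruhatLE (u⁻¹ * cs.demazure u w) w := by
  induction w using cs.induction_demazureSimple with
  | one => simpa [demazure_one_right] using cs.bruhatLE_refl 1
  | step v i h ih =>
    rw [← cs.demazureSimple_of_lt h, demazure_demazureSimple]
    rcases cs.lt_or_gt_length_mul_simple (cs.demazure u v) i with h' | h'
    · rw [cs.demazureSimple_of_lt h', ← mul_assoc]
      exact (cs.mul_simple_bruhatLE_demazureSimple _ i).trans (ih.demazureSimple i)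
    · rw [cs.demazureSimple_of_gt h']
      exact ih.trans (cs.bruhatLE_demazureSimple v i)

theorem length_demazureSimple_le (w : W) (i : B) :
    cs.length (cs.demazureSimple w i) ≤ cs.length w + 1 := by
  have := cs.length_mul_simple w i
  rw [demazureSimple]
  split_ifs <;> lia

theorem length_foldl_demazureSimple_le (ω : List B) :
    cs.length (ω.foldl cs.demazureSimple 1) ≤ ω.length := by
  induction ω using List.reverseRecOn with
  | nil => simp
  | append_singleton ω i ih =>
    have := cs.length_demazureSimple_le (ω.foldl cs.demazureSimple 1) i
    simp only [List.foldl_append, List.foldl_cons, List.foldl_nil, List.length_append,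
      List.length_singleton]
    lia

end Demazure

/-! ### The Demazure action on twisted involutions -/

section TwistedInvolutions

variable {B W : Type*} [Group W] {M : CoxeterMatrix B} {cs : CoxeterSystem M W} {star : W ≃* W}

theorem IsDiagramInvolution.exists_index (hstar : cs.IsDiagramInvolution star) (i : B) :
    ∃ j, star (cs.simple i) = cs.simple j := by
  have h : star (cs.simple i) ∈ star '' Set.range cs.simple := ⟨_, ⟨i, rfl⟩, rfl⟩
  rw [hstar.image_simple] at h
  obtain ⟨j, hj⟩ := h
  exact ⟨j, hj.symm⟩

/-- The permutation of the indices of the simple generators induced by `star`. -/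
noncomputable def IsDiagramInvolution.index (hstar : cs.IsDiagramInvolution star) (i : B) : B :=
  Classical.choose (hstar.exists_index i)

theorem IsDiagramInvolution.star_simple (hstar : cs.IsDiagramInvolution star) (i : B) :
    star (cs.simple i) = cs.simple (hstar.index i) :=
  Classical.choose_spec (hstar.exists_index i)

theorem IsDiagramInvolution.star_simple_index (hstar : cs.IsDiagramInvolution star) (i : B) :
    star (cs.simple (hstar.index i)) = cs.simple i := by
  rw [← hstar.star_simple, hstar.involutive]

theorem IsDiagramInvolution.length_star_wordProd_le (hstar : cs.IsDiagramInvolution star)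
    (ω : List B) : cs.length (star (cs.wordProd ω)) ≤ ω.length := by
  induction ω with
  | nil => simp
  | cons i ω ih =>
    rw [wordProd_cons, map_mul, hstar.star_simple, List.length_cons]
    refine (cs.length_mul_le _ _).trans ?_
    rw [length_simple]
    lia

theorem IsDiagramInvolution.length_star (hstar : cs.IsDiagramInvolution star) (w : W) :
    cs.length (star w) = cs.length w := by
  have h : ∀ w, cs.length (star w) ≤ cs.length w := by
    intro w
    obtain ⟨ω, hω, rfl⟩ := cs.exists_isReduced w
    rw [hω.eq]
    exact hstar.length_star_wordProd_le ω
  refine (h w).antisymm ?_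
  simpa [hstar.involutive] using h (star w)

theorem IsDiagramInvolution.star_demazureSimple (hstar : cs.IsDiagramInvolution star) (w : W)
    (i : B) :
    star (cs.demazureSimple w i) = cs.demazureSimple (star w) (hstar.index i) := by
  have h : cs.length (star w * cs.simple (hstar.index i)) = cs.length (w * cs.simple i) := by
    rw [← hstar.star_simple, ← map_mul, hstar.length_star]
  rw [demazureSimple, demazureSimple, h, hstar.length_star]
  split_ifs <;> simp [hstar.star_simple]

theorem IsDiagramInvolution.star_simpleDemazure_index (hstar : cs.IsDiagramInvolution star)
    (w : W) (i : B) :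
    star (cs.simpleDemazure (hstar.index i) w) = cs.simpleDemazure i (star w) := by
  have h : cs.length (cs.simple i * star w) =
      cs.length (cs.simple (hstar.index i) * w) := by
    rw [← hstar.star_simple_index, ← map_mul, hstar.length_star]
  rw [simpleDemazure, simpleDemazure, h, hstar.length_star]
  split_ifs <;> simp [hstar.star_simple_index]

theorem twistedAct_one (x : W) :
    cs.twistedAct star x 1 = x := by
  rw [twistedAct, map_one, inv_one, demazure_one_right, demazure_one_left]

theorem IsDiagramInvolution.twistedAct_simple (hstar : cs.IsDiagramInvolution star) (x : W)
    (i : B) :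
    cs.twistedAct star x (cs.simple i) =
      cs.demazureSimple (cs.simpleDemazure (hstar.index i) x) i := by
  rw [twistedAct, hstar.star_simple, inv_simple, demazure_simple_right, demazure_simple_left]

theorem IsDiagramInvolution.twistedAct_demazureSimple (hstar : cs.IsDiagramInvolution star)
    (x w : W) (i : B) :
    cs.twistedAct star x (cs.demazureSimple w i) =
      cs.twistedAct star (cs.twistedAct star x w) (cs.simple i) := by
  rw [hstar.twistedAct_simple, twistedAct, hstar.star_demazureSimple, ← simpleDemazure_inv,
    demazure_simpleDemazure, demazure_simpleDemazure, demazure_demazureSimple, twistedAct,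
    simpleDemazure_demazureSimple]

/-- Words, reduced or not, act through their Demazure product; this links involution words with
Hecke atoms. -/
theorem IsDiagramInvolution.twistedAct_foldl (hstar : cs.IsDiagramInvolution star)
    (x : W) (ω : List B) :
    cs.twistedAct star x (ω.foldl cs.demazureSimple 1) =
      ω.foldl (fun z i => cs.twistedAct star z (cs.simple i)) x := by
  induction ω using List.reverseRecOn with
  | nil => exact twistedAct_one x
  | append_singleton ω i ih =>
    simp only [List.foldl_append, List.foldl_cons, List.foldl_nil]
    rw [hstar.twistedAct_demazureSimple, ih]

theorem bruhatLE_twistedAct {x y w : W}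
    (h : cs.BruhatLE (star w * y) (x * w)) : cs.BruhatLE y (cs.twistedAct star x w) := by
  have h' := (h.trans (cs.mul_bruhatLE_demazure x w)).demazure_left (star w)⁻¹
  rw [← demazure_assoc] at h'
  have h'' := cs.mul_bruhatLE_demazure (star w)⁻¹ (star w * y)
  rw [inv_mul_cancel_left] at h''
  exact h''.trans h'

theorem IsDiagramInvolution.twistedAct_simple_mem (hstar : cs.IsDiagramInvolution star) {x : W}
    (hx : x ∈ twistedInvolutions star) (i : B) :
    cs.twistedAct star x (cs.simple i) ∈ twistedInvolutions star := by
  change _ = _ at hx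
  change _ = _
  rw [hstar.twistedAct_simple, ← simpleDemazure_inv, inv_simpleDemazure, hx,
    simpleDemazure_demazureSimple, ← hstar.star_simpleDemazure_index, ← hstar.star_demazureSimple]

theorem IsDiagramInvolution.twistedAct_mem (hstar : cs.IsDiagramInvolution star) {x : W}
    (hx : x ∈ twistedInvolutions star) (w : W) :
    cs.twistedAct star x w ∈ twistedInvolutions star := by
  induction w using cs.induction_demazureSimple with
  | one => rwa [twistedAct_one]
  | step v i h ih =>
    rw [← cs.demazureSimple_of_lt h, hstar.twistedAct_demazureSimple]
    exact hstar.twistedAct_simple_mem ih i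

theorem one_mem_twistedInvolutions : (1 : W) ∈ twistedInvolutions star := by
  simp [twistedInvolutions]

/-- Inversion followed by `star` fixes `x` and swaps the two sides, so left and right descents of
`x` correspond. -/
theorem IsDiagramInvolution.length_index_mul (hstar : cs.IsDiagramInvolution star) {x : W}
    (hx : x ∈ twistedInvolutions star) (i : B) :
    cs.length (cs.simple (hstar.index i) * x) = cs.length (x * cs.simple i) := by
  change _ = _ at hx
  rw [← hstar.length_star, map_mul, hstar.star_simple_index, ← hx, ← length_inv_mul_simple,
    inv_inv]

theorem IsDiagramInvolution.twistedAct_simple_of_gt (hstar : cs.IsDiagramInvolution star) {x : W}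
    (hx : x ∈ twistedInvolutions star) {i : B}
    (h : cs.length (x * cs.simple i) < cs.length x) :
    cs.twistedAct star x (cs.simple i) = x := by
  rw [hstar.twistedAct_simple, simpleDemazure_of_gt, demazureSimple_of_gt _ h]
  rwa [hstar.length_index_mul hx]

theorem IsDiagramInvolution.bruhatLE_of_bruhatLE_twistedAct_simple
    (hstar : cs.IsDiagramInvolution star) {y z : W} (hy : y ∈ twistedInvolutions star) {i : B}
    (h : cs.length y < cs.length (y * cs.simple i))
    (hle : cs.BruhatLE y (cs.twistedAct star z (cs.simple i))) : cs.BruhatLE y z := by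
  rw [hstar.twistedAct_simple] at hle
  refine (hle.of_demazureSimple h).of_simpleDemazure ?_
  rwa [hstar.length_index_mul hy]

theorem IsDiagramInvolution.bruhatLE_twistedAct_simple (hstar : cs.IsDiagramInvolution star)
    (z : W) (i : B) : cs.BruhatLE z (cs.twistedAct star z (cs.simple i)) := by
  rw [hstar.twistedAct_simple]
  exact (cs.bruhatLE_simpleDemazure _ z).trans (cs.bruhatLE_demazureSimple _ i)

/-- At an ascent, `s^* x s` can fail to be longer than `s^* x` only if `s^* x = x s`, which is
exactly the case split in `twistedConj`. -/
theorem IsDiagramInvolution.twistedConj_of_lt (hstar : cs.IsDiagramInvolution star) {x : W}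
    (hx : x ∈ twistedInvolutions star) {i : B}
    (h : cs.length x < cs.length (x * cs.simple i)) :
    cs.twistedConj star x i = cs.twistedAct star x (cs.simple i) := by
  have h' : cs.length x < cs.length (cs.simple (hstar.index i) * x) := by
    rwa [hstar.length_index_mul hx]
  rw [hstar.twistedAct_simple, cs.simpleDemazure_of_lt h', twistedConj, hstar.star_simple]
  split_ifs with hne
  · rcases cs.lt_or_gt_length_mul_simple (cs.simple (hstar.index i) * x) i with h2 | h2
    · rw [cs.demazureSimple_of_lt h2]
    · exact absurd (cs.simple_mul_eq_mul_simple h' h h2) hne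
  · rw [not_not] at hne
    rw [hne, cs.demazureSimple_of_gt]
    simpa using h

/-- A descent of a twisted involution can be undone. -/
theorem IsDiagramInvolution.exists_twistedConj_eq (hstar : cs.IsDiagramInvolution star) {x : W}
    (hx : x ∈ twistedInvolutions star) {i : B}
    (h : cs.length (x * cs.simple i) < cs.length x) :
    cs.twistedConj star x i ∈ twistedInvolutions star ∧
      cs.twistedAct star (cs.twistedConj star x i) (cs.simple i) = x ∧
      cs.length (cs.twistedConj star x i) < cs.length x := by
  have h' : cs.length (cs.simple (hstar.index i) * x) < cs.length x := by
    rwa [hstar.length_index_mul hx]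
  have hx' : x⁻¹ = star x := hx
  rw [twistedConj, hstar.star_simple]
  split_ifs with hne
  · have hlt : cs.length (cs.simple (hstar.index i) * x * cs.simple i) <
        cs.length (cs.simple (hstar.index i) * x) := by
      by_contra hcon
      apply hne
      have h1 := cs.length_mul_simple (cs.simple (hstar.index i) * x) i
      have h2 := cs.length_mul_simple x i
      have h3 := hstar.length_index_mul hx i
      have := cs.simple_mul_eq_mul_simple (w := x * cs.simple i) (i := hstar.index i) (j := i)
        (by rw [← mul_assoc]; lia) (by simpa using h)
        (by rw [← mul_assoc, simple_mul_simple_cancel_right]; lia)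
      rw [simple_mul_simple_cancel_right, ← mul_assoc] at this
      nth_rw 2 [← this]
      simp
    refine ⟨?_, ?_, hlt.trans h'⟩
    · change _ = _
      simp only [map_mul, mul_inv_rev, hstar.star_simple_index, inv_simple, hx', hstar.star_simple,
        mul_assoc]
    · have e : cs.simple (hstar.index i) * (cs.simple (hstar.index i) * x * cs.simple i) =
          x * cs.simple i := by
        simp [mul_assoc]
      have h1 := cs.length_mul_simple (cs.simple (hstar.index i) * x) i
      have h3 := hstar.length_index_mul hx i
      rw [hstar.twistedAct_simple, simpleDemazure_of_lt, e, demazureSimple_of_lt]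
      · simp
      · simpa using h
      · rw [e]
        lia
  · rw [not_not] at hne
    refine ⟨?_, ?_, h⟩
    · change _ = _
      rw [mul_inv_rev, map_mul, hstar.star_simple, inv_simple, hx', ← hstar.star_simple_index,
        ← map_mul, hne, map_mul, hstar.star_simple]
    · rw [hstar.twistedAct_simple, ← hne, simpleDemazure_of_lt, simple_mul_simple_cancel_left,
        demazureSimple_of_gt _ h]
      simpa using h'

end TwistedInvolutions

/-! ### Involution length, atoms and the Bruhat condition -/

section Atoms

variable {B W : Type*} [Group W] {M : CoxeterMatrix B} {cs : CoxeterSystem M W} {star : W ≃* W}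

theorem IsDiagramInvolution.twistedConj_bruhatLE (hstar : cs.IsDiagramInvolution star) {x : W}
    (hx : x ∈ twistedInvolutions star) {i : B}
    (h : cs.length (x * cs.simple i) < cs.length x) :
    cs.BruhatLE (cs.twistedConj star x i) x := by
  have := hstar.bruhatLE_twistedAct_simple (cs.twistedConj star x i) i
  rwa [(hstar.exists_twistedConj_eq hx h).2.1] at this

/-- The subword property for involution expressions. -/
theorem IsDiagramInvolution.exists_sublist_of_bruhatLE (hstar : cs.IsDiagramInvolution star)
    {y : W} (hy : y ∈ twistedInvolutions star) (ω : List B)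
    (h : cs.BruhatLE y (ω.foldl (fun z i => cs.twistedAct star z (cs.simple i)) 1)) :
    ∃ ω' : List B, ω'.Sublist ω ∧
      ω'.foldl (fun z i => cs.twistedAct star z (cs.simple i)) 1 = y := by
  induction ω using List.reverseRecOn generalizing y with
  | nil => exact ⟨[], List.Sublist.refl _, (h.eq_of_length_le (by simp)).symm⟩
  | append_singleton ω i ih =>
    rw [List.foldl_append, List.foldl_cons, List.foldl_nil] at h
    -- At an ascent of `y` the last letter is dropped by lifting; at a descent it is kept and undone
    -- in `y`.
    rcases cs.lt_or_gt_length_mul_simple y i with hi | hi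
    · obtain ⟨ω', hs, he⟩ := ih hy (hstar.bruhatLE_of_bruhatLE_twistedAct_simple hy hi h)
      exact ⟨ω', hs.trans (List.sublist_append_left _ _), he⟩
    · obtain ⟨hv, hvy, hl⟩ := hstar.exists_twistedConj_eq hy hi
      have hlt : cs.length (cs.twistedConj star y i) <
          cs.length (cs.twistedConj star y i * cs.simple i) := by
        rcases cs.lt_or_gt_length_mul_simple (cs.twistedConj star y i) i with hi' | hi'
        · exact hi'
        · rw [hstar.twistedAct_simple_of_gt hv hi'] at hvy
          rw [hvy] at hl
          exact absurd hl (lt_irrefl _)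
      obtain ⟨ω', hs, he⟩ := ih hv (hstar.bruhatLE_of_bruhatLE_twistedAct_simple hv hlt
        ((hstar.twistedConj_bruhatLE hy hi).trans h))
      refine ⟨ω' ++ [i], hs.append (List.Sublist.refl _), ?_⟩
      rw [List.foldl_append, he, List.foldl_cons, List.foldl_nil, hvy]

theorem IsDiagramInvolution.exists_foldl_eq (hstar : cs.IsDiagramInvolution star) {y : W}
    (hy : y ∈ twistedInvolutions star) :
    ∃ ω : List B, ω.foldl (fun z i => cs.twistedAct star z (cs.simple i)) 1 = y := by
  induction hn : cs.length y using Nat.strong_induction_on generalizing y with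
  | _ n ih =>
    by_cases h1 : y = 1
    · exact ⟨[], h1.symm⟩
    · obtain ⟨i, hi⟩ := cs.exists_rightDescent_of_ne_one h1
      obtain ⟨hv, hvy, hl⟩ := hstar.exists_twistedConj_eq hy hi
      obtain ⟨ω, hω⟩ := ih _ (by rwa [hn] at hl) hv rfl
      exact ⟨ω ++ [i], by rw [List.foldl_append, hω, List.foldl_cons, List.foldl_nil, hvy]⟩

theorem ellHat_foldl_le (ω : List B) :
    cs.ellHat star (ω.foldl (fun z i => cs.twistedAct star z (cs.simple i)) 1) ≤ ω.length := by
  classical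
  set y := ω.foldl (fun z i => cs.twistedAct star z (cs.simple i)) 1 with hy
  have hex : ∃ n, ∃ ω' : List B, ω' ∈ cs.involutionExpressions star 1 y ∧ ω'.length = n :=
    ⟨_, ω, hy.symm, rfl⟩
  obtain ⟨ω', hω', hl⟩ := Nat.find_spec hex
  have hmin : ∀ ω'' ∈ cs.involutionExpressions star 1 y, ω'.length ≤ ω''.length := by
    intro ω'' h
    rw [hl]
    exact Nat.find_min' hex ⟨ω'', h, rfl⟩
  have hword : ω' ∈ cs.involutionWords star 1 y := ⟨hω', hmin⟩
  exact (Nat.sInf_le (Set.mem_image_of_mem _ hword)).trans (hmin ω hy.symm)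

theorem IsDiagramInvolution.exists_length_eq_ellHat (hstar : cs.IsDiagramInvolution star) {y : W}
    (hy : y ∈ twistedInvolutions star) :
    ∃ ω : List B, ω.foldl (fun z i => cs.twistedAct star z (cs.simple i)) 1 = y ∧
      ω.length = cs.ellHat star y := by
  classical
  obtain ⟨ω, hω⟩ := hstar.exists_foldl_eq hy
  have hex : ∃ n, ∃ ω' : List B, ω' ∈ cs.involutionExpressions star 1 y ∧ ω'.length = n :=
    ⟨_, ω, hω, rfl⟩
  obtain ⟨ω', hω', hl⟩ := Nat.find_spec hex
  -- The infimum of the empty set is `0`, so a shortest word must be exhibited before `sInf` is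
  -- known to be attained.
  have hne : (List.length '' cs.involutionWords star 1 y).Nonempty := by
    refine ⟨_, ω', ⟨hω', fun ω'' h => ?_⟩, rfl⟩
    rw [hl]
    exact Nat.find_min' hex ⟨ω'', h, rfl⟩
  obtain ⟨ω'', h, hl'⟩ := Nat.sInf_mem hne
  exact ⟨ω'', h.1, hl'⟩

/-- The involution length is strictly increasing in the Bruhat order on twisted involutions. -/
theorem IsDiagramInvolution.eq_of_ellHat_le (hstar : cs.IsDiagramInvolution star) {y z : W}
    (hy : y ∈ twistedInvolutions star) (hz : z ∈ twistedInvolutions star)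
    (h : cs.BruhatLE y z) (hle : cs.ellHat star z ≤ cs.ellHat star y) : y = z := by
  obtain ⟨ω, rfl, hl⟩ := hstar.exists_length_eq_ellHat hz
  -- A shortest word for `z` contains a word for `y`; the assumed inequality leaves no room to
  -- delete a letter.
  obtain ⟨ω', hs, rfl⟩ := hstar.exists_sublist_of_bruhatLE hy ω h
  rw [hs.eq_of_length_le]
  rw [hl]
  exact hle.trans (ellHat_foldl_le ω')

theorem IsDiagramInvolution.ellHat_mono (hstar : cs.IsDiagramInvolution star) {y z : W}
    (hy : y ∈ twistedInvolutions star) (hz : z ∈ twistedInvolutions star)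
    (h : cs.BruhatLE y z) : cs.ellHat star y ≤ cs.ellHat star z := by
  by_contra hcon
  rw [hstar.eq_of_ellHat_le hy hz h (not_le.mp hcon).le] at hcon
  exact hcon le_rfl

theorem IsDiagramInvolution.ellHat_foldl_le_add (hstar : cs.IsDiagramInvolution star) {x : W}
    (hx : x ∈ twistedInvolutions star) (ω : List B) :
    cs.ellHat star (ω.foldl (fun z i => cs.twistedAct star z (cs.simple i)) x) ≤
      cs.ellHat star x + ω.length := by
  obtain ⟨ω₀, rfl, hl⟩ := hstar.exists_length_eq_ellHat hx
  rw [← hl, ← List.foldl_append, ← List.length_append]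
  exact ellHat_foldl_le _

theorem IsDiagramInvolution.ellHat_twistedAct_le (hstar : cs.IsDiagramInvolution star) {x : W}
    (hx : x ∈ twistedInvolutions star) (w : W) :
    cs.ellHat star (cs.twistedAct star x w) ≤ cs.ellHat star x + cs.length w := by
  obtain ⟨ω, hω, rfl⟩ := cs.exists_isReduced w
  rw [hω.eq, ← cs.foldl_demazureSimple_one hω, hstar.twistedAct_foldl]
  exact hstar.ellHat_foldl_le_add hx ω

/-- Descents cannot raise the involution length and ascents raise it by at most one, so each step of
a weak-order chain is an ascent contributing exactly one. -/
theorem IsDiagramInvolution.exists_foldl_eq_of_twistedWeakLE (hstar : cs.IsDiagramInvolution star)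
    {x y : W} (h : cs.TwistedWeakLE star x y) :
    ∃ ω : List B, ω.foldl (fun z i => cs.twistedAct star z (cs.simple i)) x = y ∧
      cs.ellHat star y = cs.ellHat star x + ω.length := by
  induction h with
  | refl => exact ⟨[], rfl, rfl⟩
  | @tail z z' _ h ih =>
    obtain ⟨hz, i, rfl, hlt⟩ := h
    obtain ⟨ω, hω, hl⟩ := ih
    rcases cs.lt_or_gt_length_mul_simple z i with hi | hi
    · rw [hstar.twistedConj_of_lt hz hi] at hlt ⊢
      have hle : cs.ellHat star (cs.twistedAct star z (cs.simple i)) ≤ cs.ellHat star z + 1 :=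
        hstar.ellHat_foldl_le_add hz [i]
      refine ⟨ω ++ [i], by rw [List.foldl_append, hω, List.foldl_cons, List.foldl_nil], ?_⟩
      rw [List.length_append, List.length_singleton]
      lia
    · have := hstar.ellHat_mono (hstar.exists_twistedConj_eq hz hi).1 hz
        (hstar.twistedConj_bruhatLE hz hi)
      exact absurd hlt (not_lt.mpr this)

/-- Either `x ∘ w = x w`, or `w` can be shortened without changing its action on `x`. -/
theorem IsDiagramInvolution.demazure_eq_mul_or_exists_lt (hstar : cs.IsDiagramInvolution star)
    {x : W} (hx : x ∈ twistedInvolutions star) (w : W) :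
    cs.demazure x w = x * w ∨
      ∃ v, cs.length v < cs.length w ∧ cs.twistedAct star x v = cs.twistedAct star x w := by
  induction w using cs.induction_demazureSimple with
  | one => exact Or.inl (by rw [demazure_one_right, mul_one])
  | step w i h ih =>
    have hw := cs.length_mul_simple w i
    rw [← cs.demazureSimple_of_lt h, demazure_demazureSimple, hstar.twistedAct_demazureSimple,
      cs.demazureSimple_of_lt h]
    rcases ih with ih | ⟨v, hv, he⟩
    · rcases cs.lt_or_gt_length_mul_simple (x * w) i with h' | h'
      · left
        rw [ih, cs.demazureSimple_of_lt h', mul_assoc]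
      -- Here `x ∘ w` already absorbs `s`, hence so does `(w^*)⁻¹ ∘ x ∘ w`. Being a twisted
      -- involution with descent `s`, it is fixed by `s`, so `w` can replace `w s`.
      · refine Or.inr ⟨w, h, ?_⟩
        have e : cs.demazureSimple (cs.twistedAct star x w) i = cs.twistedAct star x w := by
          rw [twistedAct, demazure_assoc, ih, ← demazure_demazureSimple, cs.demazureSimple_of_gt h']
        rcases cs.lt_or_gt_length_mul_simple (cs.twistedAct star x w) i with h2 | h2
        · rw [cs.demazureSimple_of_lt h2] at e
          rw [e] at h2
          exact absurd h2 (lt_irrefl _)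
        · rw [hstar.twistedAct_simple_of_gt (hstar.twistedAct_mem hx w) h2]
    · refine Or.inr ⟨cs.demazureSimple v i, ?_, ?_⟩
      · have := cs.length_demazureSimple_le v i
        lia
      · rw [hstar.twistedAct_demazureSimple, he]

theorem IsDiagramInvolution.star_mul_bruhatLE_of_mem_atoms (hstar : cs.IsDiagramInvolution star)
    {x y w : W} (hx : x ∈ twistedInvolutions star) (hw : w ∈ cs.atoms star x y) :
    cs.BruhatLE (star w * y) (x * w) := by
  obtain ⟨hwy, hmin⟩ := hw
  have e : cs.demazure x w = x * w := by
    refine (hstar.demazure_eq_mul_or_exists_lt hx w).resolve_right ?_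
    rintro ⟨v, hv, he⟩
    exact absurd (hmin v (he.trans hwy)) (not_le.mpr hv)
  have h := cs.inv_mul_demazure_bruhatLE (star w)⁻¹ (cs.demazure x w)
  rw [← demazure_assoc, show cs.demazure (cs.demazure (star w)⁻¹ x) w = y from hwy, inv_inv] at h
  rwa [← e]

theorem exists_mem_minLength {X : Set W} (hX : X.Nonempty) : ∃ w, w ∈ cs.minLength X := by
  obtain ⟨w, hw, h⟩ := WellFounded.has_min (measure cs.length).wf X hX
  exact ⟨w, hw, fun v hv => not_lt.mp (h v hv)⟩

theorem IsDiagramInvolution.atoms_eq_minLength (hstar : cs.IsDiagramInvolution star) {x y : W}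
    (hx : x ∈ twistedInvolutions star) (hy : y ∈ twistedInvolutions star) {ω : List B}
    (hω : ω.foldl (fun z i => cs.twistedAct star z (cs.simple i)) x = y)
    (hl : cs.ellHat star y = cs.ellHat star x + ω.length) :
    cs.atoms star x y = cs.minLength {w | cs.BruhatLE (star w * y) (x * w)} := by
  have hmem : ω.foldl cs.demazureSimple 1 ∈ cs.heckeAtoms star x y :=
    (hstar.twistedAct_foldl x ω).trans hω
  have hle : ∀ w, cs.BruhatLE (star w * y) (x * w) → ω.length ≤ cs.length w := by
    intro w hw
    have h1 := hstar.ellHat_mono hy (hstar.twistedAct_mem hx w) (bruhatLE_twistedAct hw)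
    have h2 := hstar.ellHat_twistedAct_le hx w
    lia
  -- The Demazure product of `ω` acts as `ω` does and has length at most `ω.length`.
  have hatom : ∀ w ∈ cs.atoms star x y, cs.length w ≤ ω.length := fun w hw =>
    (hw.2 _ hmem).trans (cs.length_foldl_demazureSimple_le ω)
  ext w
  constructor
  · intro hw
    exact ⟨hstar.star_mul_bruhatLE_of_mem_atoms hx hw,
      fun v hv => (hatom w hw).trans (hle v hv)⟩
  · rintro ⟨hw, hmin⟩
    obtain ⟨a, ha⟩ := cs.exists_mem_minLength ⟨_, hmem⟩
    have hwl : cs.length w ≤ ω.length :=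
      (hmin a (hstar.star_mul_bruhatLE_of_mem_atoms hx ha)).trans (hatom a ha)
    refine ⟨?_, fun v hv => ?_⟩
    -- The bound `ℓ w ≤ ω.length` caps the involution length of the image of `x` at that of `y`,
    -- while `y` lies below this image; strict monotonicity gives equality.
    · refine (hstar.eq_of_ellHat_le hy (hstar.twistedAct_mem hx w) (bruhatLE_twistedAct hw) ?_).symm
      have := hstar.ellHat_twistedAct_le hx w
      lia
    · have h := hstar.ellHat_twistedAct_le hx v
      rw [show cs.twistedAct star x v = y from hv] at h
      lia

end Atoms

end CoxeterSystem

theorem theorem4p11 {B W : Type*} [Group W] [Finite W] {M : CoxeterMatrix B}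
    (cs : CoxeterSystem M W) (star : W ≃* W) (hstar : cs.IsDiagramInvolution star) :
    (∀ w₀ : W, cs.IsLongest w₀ →
      ∀ x ∈ twistedInvolutions star, ∀ y ∈ twistedInvolutions star,
        cs.TwistedWeakLE star x y →
        (cs.length x = cs.ellHat star x ∨
          (cs.length w₀ : ℤ) - cs.length y = (cs.ellHat star w₀ : ℤ) - cs.ellHat star y) →
        cs.atoms star x y = cs.minLength {w | cs.BruhatLE (star w * y) (x * w)}) ∧
    (∀ y ∈ twistedInvolutions star,
      cs.atoms star 1 y = cs.minLength {w | cs.BruhatLE (star w * y) w}) := by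
  refine ⟨fun _ _ x hx y hy hxy _ => ?_, fun y hy => ?_⟩
  · obtain ⟨ω, hω, hl⟩ := hstar.exists_foldl_eq_of_twistedWeakLE hxy
    exact hstar.atoms_eq_minLength hx hy hω hl
  · obtain ⟨ω, hω, hl⟩ := hstar.exists_length_eq_ellHat hy
    -- The empty word expresses `1`, so a shortest involution word of `y` has the length required of
    -- a word from `1` to `y`.
    have h1 : cs.ellHat star 1 = 0 :=
      Nat.le_zero.mp (CoxeterSystem.ellHat_foldl_le (cs := cs) (star := star) [])
    have h := hstar.atoms_eq_minLength CoxeterSystem.one_mem_twistedInvolutions hy hω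
      (by rw [h1, zero_add, hl])
    simpa only [one_mul] using h
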